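/- Let $d\in\mathbb N$, let $\mathcal H_R=\mathcal F(L^2(\mathbb R^d,d^dk))$ be the bosonic Fock space, with creation and annihilation operators $a^\dagger(f),a(f)$ and number operator $\widehat N$, let $\omega:\mathbb R^d\to[0,\infty)$ be measurable, and let $h_R=d\Gamma(\omega)$ be the field Hamiltonian, so that $e^{ith_R}=\Gamma(e^{it\omega})$. For $g\in L^2(\mathbb R^d,d^dk)$ put $$v=a^\dagger(g)a(g),\qquad v(t)=e^{ith_R}\,v\,e^{-ith_R},\qquad \overline V_M(t)=\frac1M\sum_{m=1}^M v(t)^{[m]}\quad\text{on }\mathcal H_R^{\otimes M},$$ where $X^{[m]}$ denotes the operator $X$ acting on the $m$-th tensor factor. Then: (i) $v(\widehat N+1)^{-1}$ is an everywhere defined bounded operator, and $\|v(\widehat N+1)^{-1}\|\le 2\|g\|^2$. (ii) Let $\omega_R(\cdot)=\mathrm{Tr}(\rho\,\cdot)$ be the state given by a density matrix $\rho$ on $\mathcal H_R$, and suppose that for some constant $c\in\mathbb R$ $$\omega_R(\widehat N^k)\le c^k\qquad\text{for all }k\in\mathbb N.$$ Let $\omega_{R,M}(\cdot)=\mathrm{Tr}(\rho^{\otimes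 M}\,\cdot)$ be the $M$-fold product state on $\mathcal H_R^{\otimes M}$. Then for all $n\in\mathbb N$ and all $t_1,\dots,t_n\ge0$, the expectations below exist for every $M\ge1$, and $$\sup_{M\ge1}\big|\omega_{R,M}\big(\overline V_M(t_1)\cdots\overline V_M(t_n)\big)\big|\le C_{R,n}\,b_R(t_1)\cdots b_R(t_n)\quad\text{with }C_{R,n}=(2c\|g\|^2)^n,\ b_R(t)=1 .$$ -/

import Mathlib

open scoped TensorProduct InnerProductSpace

noncomputable section

namespace MeanField

/-! ### Unbounded operators -/

section Unbounded

variable {H : Type} [NormedAddCommGroup H] [InnerProductSpace ℂ H]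

/-- The product `B A` of two unbounded operators, on its natural domain
`{x ∈ D(A) | A x ∈ D(B)}`. -/
def opMul (B A : H →ₗ.[ℂ] H) : H →ₗ.[ℂ] H where
  domain := (B.domain.comap A.toFun).map A.domain.subtype
  toFun :=
    { toFun := fun x => B ⟨A ⟨x.1, by
          obtain ⟨y, _, hy⟩ := x.2; rw [← hy]; exact y.2⟩, by
          obtain ⟨x, y, hy, rfl⟩ := x; exact hy⟩
      map_add' := fun x y => by
        rw [← LinearPMap.map_add]; congr 1; apply Subtype.ext
        exact LinearPMap.map_add A ⟨x.1, _⟩ ⟨y.1, _⟩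
      map_smul' := fun c x => by
        rw [RingHom.id_apply, ← LinearPMap.map_smul]; congr 1; apply Subtype.ext
        exact LinearPMap.map_smul A c ⟨x.1, _⟩ }

/-- The identity as an everywhere defined operator. -/
def opOne : H →ₗ.[ℂ] H := LinearMap.id.toPMap ⊤

/-- The ordered product `A₁ A₂ ⋯ Aₙ` of a list of unbounded operators. -/
def opProd (l : List (H →ₗ.[ℂ] H)) : H →ₗ.[ℂ] H := l.foldr opMul opOne

/-- The power `A ^ k` of an unbounded operator. -/
def opPow (A : H →ₗ.[ℂ] H) (k : ℕ) : H →ₗ.[ℂ] H := opProd (List.replicate k A)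

/-- `A` is everywhere defined and bounded with operator norm at most `C`. -/
def IsBoundedBy (A : H →ₗ.[ℂ] H) (C : ℝ) : Prop :=
  ∀ x, ∃ hx : x ∈ A.domain, ‖A ⟨x, hx⟩‖ ≤ C * ‖x‖

end Unbounded

/-! ### Traces, density matrices and expectation values -/

section Trace

variable {H : Type} [NormedAddCommGroup H] [InnerProductSpace ℂ H] [CompleteSpace H]

/-- `T` has trace `z`: along every orthonormal basis the diagonal matrix elements are
(absolutely) summable with sum `z`. For a bounded operator this says exactly that `T` is
of trace class with `Tr T = z`. -/
def HasTrace (T : H → H) (z : ℂ) : Prop :=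
  ∀ (s : Set H) (b : HilbertBasis s ℂ H), HasSum (fun i => ⟪b i, T (b i)⟫_ℂ) z

/-- Density matrices: positive operators of trace one. -/
def IsDensityMatrix (ρ : H →L[ℂ] H) : Prop :=
  ρ.IsPositive ∧ HasTrace ρ 1

/-- The expectation `ω(A) = Tr (ρ A) = Tr (A ρ)` of the (possibly unbounded) operator `A` in the
state with density matrix `ρ` exists and equals `z`: the range of `ρ` is contained in the domain
of `A`, and `A ρ` has trace `z`. -/
def HasExpectation (ρ : H →L[ℂ] H) (A : H →ₗ.[ℂ] H) (z : ℂ) : Prop :=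
  ∃ h : ∀ x, ρ x ∈ A.domain, HasTrace (fun x => A ⟨ρ x, h x⟩) z

end Trace

/-! ### Tensor powers of a Hilbert space -/

/-- A bundled complex Hilbert space (only used for the recursion that defines tensor powers). -/
structure HilbertSpace where
  carrier : Type
  [group : NormedAddCommGroup carrier]
  [inner : InnerProductSpace ℂ carrier]
  [complete : CompleteSpace carrier]

attribute [instance] HilbertSpace.group HilbertSpace.inner HilbertSpace.complete

section TensorPower

variable (H : Type) [NormedAddCommGroup H] [InnerProductSpace ℂ H]

/-- `H^{⊗ 0} = ℂ`, and `H^{⊗ (n+1)}` is the Hilbert space completion of the algebraic tensor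
product of `H` and `H^{⊗ n}`. -/
def tensorPowerAux : ℕ → HilbertSpace
  | 0 => ⟨ℂ⟩
  | n + 1 => ⟨UniformSpace.Completion (H ⊗[ℂ] (tensorPowerAux n).carrier)⟩

/-- The Hilbert space tensor power `H ⊗ ⋯ ⊗ H` (`n` factors). -/
def TensorPower (n : ℕ) : Type := (tensorPowerAux H n).carrier

instance (n : ℕ) : NormedAddCommGroup (TensorPower H n) := (tensorPowerAux H n).group

instance (n : ℕ) : InnerProductSpace ℂ (TensorPower H n) := (tensorPowerAux H n).inner

instance (n : ℕ) : CompleteSpace (TensorPower H n) := (tensorPowerAux H n).complete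

variable {H}

/-- The map `ψ ↦ x ⊗ ψ` from `H^{⊗ n}` to `H^{⊗ (n+1)}`. -/
def tensorCons (x : H) (n : ℕ) : TensorPower H n →L[ℂ] TensorPower H (n + 1) :=
  (UniformSpace.Completion.toComplL (𝕜 := ℂ) (E := H ⊗[ℂ] TensorPower H n)).comp
    (TensorProduct.mkL ℂ H (TensorPower H n) x)

/-- The pure tensor `x₀ ⊗ ⋯ ⊗ x_{n-1}`. -/
def pureTensor : (n : ℕ) → (Fin n → H) → TensorPower H n
  | 0, _ => (1 : ℂ)
  | n + 1, x => tensorCons (x 0) n (pureTensor n (Fin.tail x))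

/-- The tensor power `A ⊗ ⋯ ⊗ A` of a bounded operator. -/
def tensorMap (A : H →L[ℂ] H) : (n : ℕ) → (TensorPower H n →L[ℂ] TensorPower H n)
  | 0 => ContinuousLinearMap.id ℂ _
  | n + 1 => (TensorProduct.mapL A (tensorMap A n)).completion

/-- The operator `A^{[m]} = 1 ⊗ ⋯ ⊗ A ⊗ ⋯ ⊗ 1` on `H^{⊗ n}`, with the unbounded operator `A` on the
`m`-th factor: the closure of its restriction to the span of the pure tensors whose `m`-th factor
lies in the domain of `A`. -/
def siteOp (A : H →ₗ.[ℂ] H) {n : ℕ} (m : Fin n) : TensorPower H n →ₗ.[ℂ] TensorPower H n :=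
  (Submodule.span ℂ {p : TensorPower H n × TensorPower H n |
    ∃ (x : Fin n → H) (h : x m ∈ A.domain),
      p = (pureTensor n x, pureTensor n (Function.update x m (A ⟨x m, h⟩)))}
    ).topologicalClosure.toLinearPMap

/-- The mean field operator `M⁻¹ ∑_m A^{[m]}` on `H^{⊗ M}`. -/
def meanField (A : H →ₗ.[ℂ] H) (M : ℕ) : TensorPower H M →ₗ.[ℂ] TensorPower H M :=
  (M : ℂ)⁻¹ • ∑ m : Fin M, siteOp A m

end TensorPower

/-- The moment bound on the reservoir: for all `n`, all times `t₁, …, tₙ ≥ 0` and all `M ≥ 1`, the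
expectation of `V̄_M(t₁) ⋯ V̄_M(tₙ)` in the state with density matrix `ρM M` exists and is bounded
in modulus by `C n * b t₁ ⋯ b tₙ`. Here `V̄_M(t) = M⁻¹ ∑_m v(t)^{[m]}`. -/
def ReservoirBound {H : Type} [NormedAddCommGroup H] [InnerProductSpace ℂ H]
    (ρM : (M : ℕ) → (TensorPower H M →L[ℂ] TensorPower H M)) (v : ℝ → (H →ₗ.[ℂ] H))
    (C : ℕ → ℝ) (b : ℝ → ℝ) : Prop :=
  ∀ (n : ℕ) (t : Fin n → ℝ), (∀ i, 0 ≤ t i) → ∀ M : ℕ, 1 ≤ M →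
    ∃ z : ℂ, HasExpectation (ρM M) (opProd (List.ofFn fun i => meanField (v (t i)) M)) z ∧
      ‖z‖ ≤ C n * ∏ i, b (t i)

/-! ### Bosonic Fock space -/

section Fock

variable (h : Type) [NormedAddCommGroup h] [InnerProductSpace ℂ h]

/-- The symmetric subspace of `h^{⊗ n}`: the closure of the range of the symmetrization. -/
def symSubspace (n : ℕ) : Submodule ℂ (TensorPower h n) :=
  (Submodule.span ℂ (Set.range fun x : Fin n → h =>
    ∑ σ : Equiv.Perm (Fin n), pureTensor n (x ∘ σ))).topologicalClosure

instance (n : ℕ) : CompleteSpace (symSubspace h n) :=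
  (Submodule.isClosed_topologicalClosure _).completeSpace_coe

/-- The `n`-particle space. -/
abbrev Sector (n : ℕ) : Type := symSubspace h n

/-- The bosonic Fock space over `h`: the Hilbert space direct sum of the `n`-particle spaces. -/
abbrev Fock : Type := lp (Sector h) 2

variable {h}

/-- The operator on Fock space that acts on sequences `(ψₙ)` by `L`, on its maximal domain, the set
of all `ψ` for which `L ψ` is again square summable. -/
def maxOp (L : (∀ n, Sector h n) →ₗ[ℂ] (∀ n, Sector h n)) : Fock h →ₗ.[ℂ] Fock h where
  domain :=
    { carrier := {ψ | Memℓp (L ψ) 2}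
      add_mem' := fun {ψ φ} hψ hφ => by
        simp only [Set.mem_ofPred_eq, lp.coeFn_add, map_add] at *
        exact hψ.add hφ
      zero_mem' := by
        simp only [Set.mem_ofPred_eq, lp.coeFn_zero, map_zero]
        exact zero_memℓp
      smul_mem' := fun c ψ hψ => by
        simp only [Set.mem_ofPred_eq, lp.coeFn_smul, map_smul] at *
        exact hψ.const_smul c }
  toFun :=
    { toFun := fun ψ => ⟨L ψ.1, ψ.2⟩
      map_add' := fun ψ φ => by
        apply Subtype.ext
        exact map_add L _ _
      map_smul' := fun c ψ => by
        apply Subtype.ext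
        exact map_smul L c _ }

/-- `a†(f)` from the `n`-particle to the `(n+1)`-particle space: `ψ ↦ √(n+1) S (f ⊗ ψ)`, where `S`
is the orthogonal projection onto the symmetric tensors. -/
def createSector (f : h) (n : ℕ) : Sector h n →L[ℂ] Sector h (n + 1) :=
  ((Real.sqrt (n + 1) : ℝ) : ℂ) •
    ((symSubspace h (n + 1)).orthogonalProjectionOnto.comp (tensorCons f n)).comp
      (symSubspace h n).subtypeL

/-- `a(f)` from the `(n+1)`-particle to the `n`-particle space, the adjoint of `a†(f)`. -/
def annihilateSector (f : h) (n : ℕ) : Sector h (n + 1) →L[ℂ] Sector h n :=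
  ContinuousLinearMap.adjoint (createSector f n)

/-- The creation operator `a†(f)`. -/
def create (f : h) : Fock h →ₗ.[ℂ] Fock h :=
  maxOp (LinearMap.pi fun n => match n with
    | 0 => 0
    | n + 1 => (createSector f n).toLinearMap ∘ₗ LinearMap.proj n)

/-- The annihilation operator `a(f)`. -/
def annihilate (f : h) : Fock h →ₗ.[ℂ] Fock h :=
  maxOp (LinearMap.pi fun n => (annihilateSector f n).toLinearMap ∘ₗ LinearMap.proj (n + 1))

/-- The number operator, equal to `n` on the `n`-particle space. -/
def number : Fock h →ₗ.[ℂ] Fock h :=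
  maxOp (LinearMap.pi fun n => (n : ℂ) • LinearMap.proj n)

/-- The second quantization `Γ(U)`, equal to `U ⊗ ⋯ ⊗ U` on the `n`-particle space (which that
operator leaves invariant, so that the projection onto the symmetric tensors does nothing). -/
def secondQuantization (U : h →L[ℂ] h) : Fock h →ₗ.[ℂ] Fock h :=
  maxOp (LinearMap.pi fun n =>
    (((symSubspace h n).orthogonalProjectionOnto.comp (tensorMap U n)).comp
      (symSubspace h n).subtypeL).toLinearMap ∘ₗ LinearMap.proj n)

/-- The scattering interaction `a†(g) a(g)`. -/
def scattering (g : h) : Fock h →ₗ.[ℂ] Fock h := opMul (create g) (annihilate g)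

end Fock

/-! ### The free field over `L²(ℝᵈ)` -/

section Field

/-- The one-particle space `L²(ℝᵈ, dᵈk)`. -/
abbrev OneParticle (d : ℕ) : Type :=
  MeasureTheory.Lp ℂ 2 (MeasureTheory.volume : MeasureTheory.Measure (EuclideanSpace ℝ (Fin d)))

variable {d : ℕ}

lemma memLp_phase {θ : EuclideanSpace ℝ (Fin d) → ℝ} (hθ : Measurable θ) (f : OneParticle d) :
    MeasureTheory.MemLp (fun k => Complex.exp (Complex.I * θ k) * f k) 2
      MeasureTheory.volume := by
  refine (MeasureTheory.Lp.memLp f).of_le (AEMeasurable.aestronglyMeasurable ?_) ?_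
  · have := (MeasureTheory.Lp.memLp f).aestronglyMeasurable.aemeasurable
    have h2 : Measurable fun k => Complex.exp (Complex.I * θ k) := by fun_prop
    exact h2.aemeasurable.mul this
  · refine Filter.Eventually.of_forall fun k => ?_
    rw [norm_mul, mul_comm Complex.I, Complex.norm_exp_ofReal_mul_I, one_mul]

/-- Multiplication by the phase `e^{iθ(k)}` on `L²(ℝᵈ)`. -/
def phase (θ : EuclideanSpace ℝ (Fin d) → ℝ) (hθ : Measurable θ) :
    OneParticle d →L[ℂ] OneParticle d :=
  LinearMap.mkContinuous
    { toFun := fun f => (memLp_phase hθ f).toLp _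
      map_add' := fun f g => by
        rw [← MeasureTheory.MemLp.toLp_add, MeasureTheory.MemLp.toLp_eq_toLp_iff]
        filter_upwards [MeasureTheory.Lp.coeFn_add f g] with k hk
        rw [Pi.add_apply, hk, Pi.add_apply, mul_add]
      map_smul' := fun c f => by
        rw [RingHom.id_apply, ← MeasureTheory.MemLp.toLp_const_smul,
          MeasureTheory.MemLp.toLp_eq_toLp_iff]
        filter_upwards [MeasureTheory.Lp.coeFn_smul c f] with k hk
        simp only [hk, Pi.smul_apply, smul_eq_mul]
        ring } 1 fun f => by
      rw [one_mul]
      refine MeasureTheory.Lp.norm_le_norm_of_ae_le ?_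
      filter_upwards [(memLp_phase hθ f).coeFn_toLp] with k hk
      simp only [LinearMap.coe_mk, AddHom.coe_mk]
      rw [hk, norm_mul, mul_comm Complex.I, Complex.norm_exp_ofReal_mul_I, one_mul]

/-- The unitary group `e^{i t h_R} = Γ(e^{i t ω})` generated by the field Hamiltonian
`h_R = dΓ(ω)`. -/
def fieldGroup (ω : EuclideanSpace ℝ (Fin d) → ℝ) (hω : Measurable ω) (t : ℝ) :
    Fock (OneParticle d) →ₗ.[ℂ] Fock (OneParticle d) :=
  secondQuantization (phase (fun k => t * ω k) (hω.const_mul t))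

/-- The free Heisenberg evolution `A(t) = e^{i t h_R} A e^{-i t h_R}`. -/
def heisenberg (ω : EuclideanSpace ℝ (Fin d) → ℝ) (hω : Measurable ω)
    (A : Fock (OneParticle d) →ₗ.[ℂ] Fock (OneParticle d)) (t : ℝ) :
    Fock (OneParticle d) →ₗ.[ℂ] Fock (OneParticle d) :=
  opMul (fieldGroup ω hω t) (opMul A (fieldGroup ω hω (-t)))

end Field

end MeanField

end

/-! If all moments satisfy `ω_R(N^k) ≤ c^k`, then `ρ` gives no weight to the sectors with more than
`c` particles: a sector `n > c` of weight `p` would contribute `p n^k`, which outgrows `c^k`. Hence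
`P ρ = ρ` for the projection `P` onto at most `⌊c⌋` particles. The operators `v(t)` preserve the
particle number, and on the range of `P` they are bounded by `c ‖g‖²`, because
`‖a†(g) a(g)‖ ≤ n ‖g‖²` on the `n`-particle sector. On the range of `P^{⊗M}` every mean field
`V_M(t)` therefore agrees with a bounded operator that commutes with `P^{⊗M}` and has norm at most
`c ‖g‖²`, uniformly in `M`. Writing `ρ^{⊗M}` as a countable mixture of rank-one operators, supported
in that range, bounds the expectation of a product by the product of these norms. -/

noncomputable section

namespace MeanField

section Graph

section LinearPMap

variable {R E F : Type*} [Ring R] [AddCommGroup E] [Module R E] [AddCommGroup F] [Module R F]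

lemma exists_apply_eq_of_mem_graph {A : E →ₗ.[R] F} {x : E} {y : F} (h : (x, y) ∈ A.graph) :
    ∃ hx : x ∈ A.domain, A ⟨x, hx⟩ = y := by
  obtain ⟨u, rfl, rfl⟩ := (LinearPMap.mem_graph_iff _).1 h
  exact ⟨u.2, rfl⟩

lemma mem_graph_add {A B : E →ₗ.[R] F} {x : E} {y z : F} (hA : (x, y) ∈ A.graph)
    (hB : (x, z) ∈ B.graph) : (x, y + z) ∈ (A + B).graph := by
  obtain ⟨hxA, rfl⟩ := exists_apply_eq_of_mem_graph hA
  obtain ⟨hxB, rfl⟩ := exists_apply_eq_of_mem_graph hB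
  exact LinearPMap.mem_graph (A + B) ⟨x, hxA, hxB⟩

lemma mem_graph_sum {ι : Type*} (s : Finset ι) {A : ι → E →ₗ.[R] F} {x : E} {y : ι → F}
    (h : ∀ i ∈ s, (x, y i) ∈ (A i).graph) : (x, ∑ i ∈ s, y i) ∈ (∑ i ∈ s, A i).graph := by
  classical
  induction s using Finset.induction_on with
  | empty => exact LinearPMap.mem_graph (0 : E →ₗ.[R] F) ⟨x, trivial⟩
  | insert i s hi ih =>
    rw [Finset.sum_insert hi, Finset.sum_insert hi]
    exact mem_graph_add (h i (Finset.mem_insert_self _ _))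
      (ih fun j hj => h j (Finset.mem_insert_of_mem hj))

lemma mem_graph_smul {M : Type*} [Monoid M] [DistribMulAction M F] [SMulCommClass R M F]
    {A : E →ₗ.[R] F} {x : E} {y : F} (c : M) (h : (x, y) ∈ A.graph) :
    (x, c • y) ∈ (c • A).graph := by
  rw [LinearPMap.smul_graph]
  exact ⟨(x, y), h, rfl⟩

lemma mem_graph_inverse {A : E →ₗ.[R] F} (hA : ∀ x, (x, 0) ∈ A.graph → x = 0) {x : E} {y : F} :
    (y, x) ∈ A.inverse.graph ↔ (x, y) ∈ A.graph := by
  have h_ker : LinearMap.ker A.toFun = ⊥ := LinearMap.ker_eq_bot'.2 fun u hu =>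
    Subtype.ext (hA u ((LinearPMap.mem_graph_iff _).2 ⟨u, rfl, hu⟩))
  rw [LinearPMap.inverse_graph h_ker]
  refine ⟨?_, fun h => ⟨(x, y), h, rfl⟩⟩
  rintro ⟨⟨_, _⟩, h, ⟨⟩⟩
  exact h

end LinearPMap

variable {H : Type} [NormedAddCommGroup H] [InnerProductSpace ℂ H]

lemma mem_graph_opMul {A B : H →ₗ.[ℂ] H} {x z : H} :
    (x, z) ∈ (opMul B A).graph ↔ ∃ y, (x, y) ∈ A.graph ∧ (y, z) ∈ B.graph := by
  constructor
  · intro h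
    obtain ⟨⟨u, hu, rfl⟩, rfl⟩ := exists_apply_eq_of_mem_graph h
    exact ⟨A u, A.mem_graph u, B.mem_graph ⟨A u, hu⟩⟩
  · rintro ⟨y, hxy, hyz⟩
    obtain ⟨hx, rfl⟩ := exists_apply_eq_of_mem_graph hxy
    obtain ⟨hy, rfl⟩ := exists_apply_eq_of_mem_graph hyz
    exact (opMul B A).mem_graph ⟨x, ⟨x, hx⟩, hy, rfl⟩

lemma mem_graph_opOne {x y : H} : (x, y) ∈ (opOne : H →ₗ.[ℂ] H).graph ↔ y = x := by
  refine ⟨fun h => ?_, ?_⟩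
  · obtain ⟨-, rfl⟩ := exists_apply_eq_of_mem_graph h
    rfl
  · rintro rfl
    exact (opOne : H →ₗ.[ℂ] H).mem_graph ⟨y, trivial⟩

lemma mem_graph_opProd_ofFn {S : Set H} : ∀ {n : ℕ} {A : Fin n → H →ₗ.[ℂ] H}
    {T : Fin n → H →L[ℂ] H}, (∀ i, ∀ x ∈ S, (x, T i x) ∈ (A i).graph) →
    (∀ i, Set.MapsTo (T i) S S) → ∀ x ∈ S,
    (x, (List.ofFn T).prod x) ∈ (opProd (List.ofFn A)).graph ∧ (List.ofFn T).prod x ∈ S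
  | 0, _, _, _, _, x, hx => ⟨mem_graph_opOne.2 rfl, hx⟩
  | n + 1, A, T, hA, hT, x, hx => by
    obtain ⟨h_graph, h_mem⟩ := mem_graph_opProd_ofFn (fun i => hA i.succ) (fun i => hT i.succ) x hx
    simp only [List.ofFn_succ, List.prod_cons, opProd, List.foldr_cons]
    exact ⟨mem_graph_opMul.2 ⟨_, h_graph, hA 0 _ h_mem⟩, hT 0 h_mem⟩

lemma IsBoundedBy.mono {A : H →ₗ.[ℂ] H} {C C' : ℝ} (h : IsBoundedBy A C) (hC : C ≤ C') :
    IsBoundedBy A C' := fun x =>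
  (h x).imp fun _ hx => hx.trans (mul_le_mul_of_nonneg_right hC (norm_nonneg x))

end Graph

section Norm

lemma norm_list_prod_le_pow {R : Type*} [SeminormedRing R] (h_one : ‖(1 : R)‖ ≤ 1) {C : ℝ}
    (hC : 0 ≤ C) : ∀ {l : List R}, (∀ a ∈ l, ‖a‖ ≤ C) → ‖l.prod‖ ≤ C ^ l.length
  | [], _ => by simpa only [List.prod_nil, List.length_nil, pow_zero] using h_one
  | a :: l, h => by
    rw [List.prod_cons, List.length_cons, pow_succ']
    exact (norm_mul_le _ _).trans (mul_le_mul (h a List.mem_cons_self)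
      (norm_list_prod_le_pow h_one hC fun b hb => h b (List.mem_cons_of_mem a hb))
      (norm_nonneg _) hC)

variable {𝕜 E F : Type*} [NontriviallyNormedField 𝕜] [NormedAddCommGroup E] [NormedSpace 𝕜 E]
  [NormedAddCommGroup F] [NormedSpace 𝕜 F]

lemma norm_completion_le (f : E →L[𝕜] F) : ‖f.completion‖ ≤ ‖f‖ := by
  refine f.completion.opNorm_le_bound (norm_nonneg _) fun x => ?_
  refine UniformSpace.Completion.induction_on x
    (isClosed_le f.completion.continuous.norm (continuous_const.mul continuous_norm)) fun a => ?_
  rw [ContinuousLinearMap.completion_apply_coe, UniformSpace.Completion.norm_coe,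
    UniformSpace.Completion.norm_coe]
  exact f.le_opNorm a

lemma mem_of_dense_span {s : Set E} (hs : Dense (Submodule.span 𝕜 s : Set E))
    {S : Submodule 𝕜 E} (hS : IsClosed (S : Set E)) (hsS : s ⊆ S) (x : E) : x ∈ S :=
  hS.closure_subset_iff.2 (Submodule.span_le.2 hsS) (hs x)

lemma tendsto_apply_of_dense_span {ι : Type*} {l : Filter ι} {T : ι → E →L[𝕜] F} {L : E →L[𝕜] F}
    {C : NNReal} (hT : ∀ i, ‖T i‖ ≤ C) {s : Set E} (hs : Dense (Submodule.span 𝕜 s : Set E))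
    (h : ∀ x ∈ s, Filter.Tendsto (fun i => T i x) l (nhds (L x))) (x : E) :
    Filter.Tendsto (fun i => T i x) l (nhds (L x)) := by
  have h_equicontinuous : Equicontinuous fun i => ⇑(T i) :=
    (LipschitzWith.uniformEquicontinuous _ C fun i =>
      (T i).lipschitz.weaken (hT i)).equicontinuous
  have h_span : ∀ y ∈ Submodule.span 𝕜 s, Filter.Tendsto (fun i => T i y) l (nhds (L y)) := by
    intro y hy
    induction hy using Submodule.span_induction with
    | mem y hy => exact h y hy
    | zero => simpa only [map_zero] using tendsto_const_nhds
    | add y z _ _ hy hz => simpa only [map_add] using hy.add hz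
    | smul c y _ hy => simpa only [map_smul] using hy.const_smul c
  exact (h_equicontinuous x).tendsto_of_mem_closure (L.continuous.tendsto x |>.mono_left
    inf_le_left) h_span (hs x)

end Norm

section CompletedTensorProduct

variable {𝕜 H K : Type*} [RCLike 𝕜] [NormedAddCommGroup H] [InnerProductSpace 𝕜 H]
  [NormedAddCommGroup K] [InnerProductSpace 𝕜 K]

variable (𝕜 H K) in
/-- The canonical bilinear map `(x, y) ↦ x ⊗ y` into the Hilbert space tensor product, which is
the completion of the algebraic one. -/
def hilbertTmul : H →L[𝕜] K →L[𝕜] UniformSpace.Completion (H ⊗[𝕜] K) :=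
  (ContinuousLinearMap.compL 𝕜 K (H ⊗[𝕜] K) _ UniformSpace.Completion.toComplL).comp
    (TensorProduct.mkL 𝕜 H K)

lemma norm_hilbertTmul (x : H) (y : K) : ‖hilbertTmul 𝕜 H K x y‖ = ‖x‖ * ‖y‖ :=
  (UniformSpace.Completion.norm_coe (x ⊗ₜ[𝕜] y)).trans (TensorProduct.norm_tmul x y)

lemma inner_hilbertTmul (x x' : H) (y y' : K) :
    ⟪hilbertTmul 𝕜 H K x y, hilbertTmul 𝕜 H K x' y'⟫_𝕜 = ⟪x, x'⟫_𝕜 * ⟪y, y'⟫_𝕜 :=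
  (UniformSpace.Completion.inner_coe (𝕜 := 𝕜) (x ⊗ₜ[𝕜] y) (x' ⊗ₜ[𝕜] y')).trans
    (TensorProduct.inner_tmul 𝕜 x x' y y')

lemma completion_mapL_hilbertTmul (A : H →L[𝕜] H) (B : K →L[𝕜] K) (x : H) (y : K) :
    (TensorProduct.mapL A B).completion (hilbertTmul 𝕜 H K x y) =
      hilbertTmul 𝕜 H K (A x) (B y) :=
  ContinuousLinearMap.completion_apply_coe (TensorProduct.mapL A B) (x ⊗ₜ[𝕜] y)

variable (𝕜 H K) in
lemma dense_span_range_hilbertTmul :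
    Dense (Submodule.span 𝕜 (Set.range fun p : H × K => hilbertTmul 𝕜 H K p.1 p.2) :
      Set (UniformSpace.Completion (H ⊗[𝕜] K))) := by
  refine UniformSpace.Completion.denseRange_coe.mono ?_
  rintro - ⟨a, rfl⟩
  induction a using TensorProduct.induction_on with
  | zero =>
    exact (UniformSpace.Completion.coe_zero (α := H ⊗[𝕜] K)) ▸ Submodule.zero_mem _
  | tmul x y => exact Submodule.subset_span ⟨(x, y), rfl⟩
  | add a b ha hb =>
    rw [UniformSpace.Completion.coe_add]
    exact Submodule.add_mem _ ha hb

end CompletedTensorProduct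

section Mixture

lemma hasSum_bilinear {𝕜 E F G ι κ : Type*} [NontriviallyNormedField 𝕜]
    [NormedAddCommGroup E] [NormedSpace 𝕜 E] [NormedAddCommGroup F] [NormedSpace 𝕜 F]
    [NormedAddCommGroup G] [NormedSpace 𝕜 G] (B : E →L[𝕜] F →L[𝕜] G) {f : ι → E} {g : κ → F}
    {a : E} {b : F} (hf : HasSum f a) (hg : HasSum g b)
    (hfg : Summable fun p : ι × κ => B (f p.1) (g p.2)) :
    HasSum (fun p : ι × κ => B (f p.1) (g p.2)) (B a b) := by
  have h_iterated := hfg.hasSum.prod_fiberwise fun i => hg.mapL (B (f i))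
  have h_eq : B a b = ∑' p : ι × κ, B (f p.1) (g p.2) := (hf.mapL (B.flip b)).unique h_iterated
  exact h_eq ▸ hfg.hasSum

variable {𝕜 H K ι κ : Type*} [RCLike 𝕜] [NormedAddCommGroup H] [InnerProductSpace 𝕜 H]
  [NormedAddCommGroup K] [InnerProductSpace 𝕜 K]

lemma hasSum_norm_inner_sq (b : HilbertBasis ι 𝕜 H) (x : H) :
    HasSum (fun i => ‖⟪b i, x⟫_𝕜‖ ^ 2) (‖x‖ ^ 2) := by
  rw [← inner_self_eq_norm_sq (𝕜 := 𝕜)]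
  convert! (b.hasSum_inner_mul_inner x x).mapL RCLike.reCLM using 2 with i
  rw [← inner_conj_symm x, RCLike.conj_mul, RCLike.reCLM_apply, ← RCLike.ofReal_pow,
    RCLike.ofReal_re]

lemma summable_prod_norm_inner_sq (b : HilbertBasis ι 𝕜 H) {u : κ → H}
    (hu : Summable fun k => ‖u k‖ ^ 2) :
    Summable fun p : κ × ι => ‖⟪b p.2, u p.1⟫_𝕜‖ ^ 2 := by
  rw [summable_prod_of_nonneg fun _ => by positivity]
  refine ⟨fun k => (hasSum_norm_inner_sq b (u k)).summable, ?_⟩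
  simpa only [(hasSum_norm_inner_sq b _).tsum_eq] using hu

lemma summable_prod_inner_mul_inner (b : HilbertBasis ι 𝕜 H) {u v : κ → H}
    (hu : Summable fun k => ‖u k‖ ^ 2) (hv : Summable fun k => ‖v k‖ ^ 2) :
    Summable fun p : κ × ι => ⟪u p.1, b p.2⟫_𝕜 * ⟪b p.2, v p.1⟫_𝕜 := by
  refine .of_norm_bounded ((summable_prod_norm_inner_sq b hu).add
    (summable_prod_norm_inner_sq b hv)) fun p => ?_
  rw [norm_mul, norm_inner_symm]
  nlinarith [two_mul_le_add_sq ‖⟪b p.2, u p.1⟫_𝕜‖ ‖⟪b p.2, v p.1⟫_𝕜‖,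
    sq_nonneg ‖⟪b p.2, u p.1⟫_𝕜‖, sq_nonneg ‖⟪b p.2, v p.1⟫_𝕜‖]

lemma summable_rankOne {u : ι → H} (hu : Summable fun k => ‖u k‖ ^ 2) [CompleteSpace H] :
    Summable fun k => InnerProductSpace.rankOne 𝕜 (u k) (u k) :=
  .of_norm_bounded hu fun k => by rw [InnerProductSpace.norm_rankOne, sq]

lemma hasSum_inner_smul [CompleteSpace H] {u : ι → H} (hu : Summable fun k => ‖u k‖ ^ 2) (x : H) :
    HasSum (fun k => ⟪u k, x⟫_𝕜 • u k) ((∑' k, InnerProductSpace.rankOne 𝕜 (u k) (u k)) x) :=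
  (summable_rankOne hu).hasSum.mapL (ContinuousLinearMap.apply 𝕜 H x)

lemma hasSum_inner_smul_of_dense_span [CompleteSpace H] {u : ι → H}
    (hu : Summable fun k => ‖u k‖ ^ 2) {T : H →L[𝕜] H} {s : Set H}
    (hs : Dense (Submodule.span 𝕜 s : Set H))
    (h : ∀ x ∈ s, HasSum (fun k => ⟪u k, x⟫_𝕜 • u k) (T x)) (x : H) :
    HasSum (fun k => ⟪u k, x⟫_𝕜 • u k) (T x) := by
  have h_eq : ∑' k, InnerProductSpace.rankOne 𝕜 (u k) (u k) = T :=
    ContinuousLinearMap.ext_on hs fun y hy => (hasSum_inner_smul hu y).unique (h y hy)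
  exact h_eq ▸ hasSum_inner_smul hu x

/-- `u` exhibits `ρ` as a mixture of the pure states `uₖ / ‖uₖ‖` with weights `‖uₖ‖²`, that is
`ρ = ∑ₖ |uₖ⟩⟨uₖ|`. The `uₖ` need not be orthogonal, so that no spectral theorem is needed to
find them and tensor products of mixtures are mixtures. -/
structure IsMixture (ρ : H →L[𝕜] H) (u : ι → H) : Prop where
  hasSum_norm_sq : HasSum (fun k => ‖u k‖ ^ 2) 1
  hasSum_apply : ∀ x, HasSum (fun k => ⟪u k, x⟫_𝕜 • u k) (ρ x)

variable {ρ : H →L[𝕜] H} {u : ι → H}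

variable (𝕜) in
lemma isMixture_id : IsMixture (ContinuousLinearMap.id 𝕜 𝕜) (fun _ : Unit => 1) where
  hasSum_norm_sq := by simp
  hasSum_apply x := by simp

lemma inner_hilbertTmul_smul_hilbertTmul (x x' : H) (y y' : K) :
    ⟪hilbertTmul 𝕜 H K x y, hilbertTmul 𝕜 H K x' y'⟫_𝕜 • hilbertTmul 𝕜 H K x y =
      hilbertTmul 𝕜 H K (⟪x, x'⟫_𝕜 • x) (⟪y, y'⟫_𝕜 • y) := by
  rw [inner_hilbertTmul, map_smul, map_smul, smul_apply, smul_smul, mul_comm]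

lemma IsMixture.tensor {σ : K →L[𝕜] K} {w : κ → K} (hρ : IsMixture ρ u) (hσ : IsMixture σ w) :
    IsMixture (TensorProduct.mapL ρ σ).completion
      (fun p : ι × κ => hilbertTmul 𝕜 H K (u p.1) (w p.2)) := by
  have h_sum : HasSum (fun p : ι × κ => ‖hilbertTmul 𝕜 H K (u p.1) (w p.2)‖ ^ 2) 1 := by
    simp only [norm_hilbertTmul, mul_pow]
    simpa only [one_mul] using hρ.hasSum_norm_sq.mul hσ.hasSum_norm_sq
      (hρ.hasSum_norm_sq.summable.mul_of_nonneg hσ.hasSum_norm_sq.summable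
        (fun _ => sq_nonneg _) (fun _ => sq_nonneg _))
  refine ⟨h_sum, hasSum_inner_smul_of_dense_span h_sum.summable
    (dense_span_range_hilbertTmul 𝕜 H K) ?_⟩
  rintro - ⟨⟨x, y⟩, rfl⟩
  have h_summable : Summable fun p : ι × κ =>
      hilbertTmul 𝕜 H K (⟪u p.1, x⟫_𝕜 • u p.1) (⟪w p.2, y⟫_𝕜 • w p.2) := by
    simpa only [inner_hilbertTmul_smul_hilbertTmul] using
      (hasSum_inner_smul (𝕜 := 𝕜) h_sum.summable (hilbertTmul 𝕜 H K x y)).summable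
  simpa only [completion_mapL_hilbertTmul, inner_hilbertTmul_smul_hilbertTmul] using
    hasSum_bilinear (hilbertTmul 𝕜 H K) (hρ.hasSum_apply x) (hσ.hasSum_apply y) h_summable

end Mixture

section Trace

variable {𝕜 H ι : Type*} [RCLike 𝕜] [NormedAddCommGroup H] [InnerProductSpace 𝕜 H]

lemma norm_inner_apply_self_le (T : H →L[𝕜] H) (x : H) : ‖⟪x, T x⟫_𝕜‖ ≤ ‖T‖ * ‖x‖ ^ 2 :=
  calc ‖⟪x, T x⟫_𝕜‖ ≤ ‖x‖ * ‖T x‖ := norm_inner_le_norm _ _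
    _ ≤ ‖x‖ * (‖T‖ * ‖x‖) := by gcongr; exact T.le_opNorm x
    _ = ‖T‖ * ‖x‖ ^ 2 := by ring

lemma summable_norm_apply_sq {u : ι → H} (hu : Summable fun k => ‖u k‖ ^ 2) (T : H →L[𝕜] H) :
    Summable fun k => ‖T (u k)‖ ^ 2 := by
  refine .of_nonneg_of_le (fun _ => sq_nonneg _) (fun k => ?_) (hu.mul_left (‖T‖ ^ 2))
  rw [← mul_pow]
  gcongr
  exact T.le_opNorm _

lemma IsMixture.norm_tsum_inner_le {ρ : H →L[𝕜] H} {u : ι → H} (h : IsMixture ρ u)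
    (T : H →L[𝕜] H) : ‖∑' k, ⟪u k, T (u k)⟫_𝕜‖ ≤ ‖T‖ := by
  simpa only [mul_one] using
    tsum_of_norm_bounded (h.hasSum_norm_sq.mul_left ‖T‖) fun k => norm_inner_apply_self_le T (u k)

end Trace

section DensityMatrix

variable {H : Type} [NormedAddCommGroup H] [InnerProductSpace ℂ H]

lemma IsMixture.hasTrace {ι : Type*} {ρ : H →L[ℂ] H} {u : ι → H} (h : IsMixture ρ u)
    (T : H →L[ℂ] H) : HasTrace (fun x => T (ρ x)) (∑' k, ⟪u k, T (u k)⟫_ℂ) := by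
  intro s b
  have h_double := summable_prod_inner_mul_inner b h.hasSum_norm_sq.summable
    (summable_norm_apply_sq h.hasSum_norm_sq.summable T)
  have h_basis := h_double.hasSum.prod_fiberwise fun k => b.hasSum_inner_mul_inner (u k) (T (u k))
  rw [h_basis.tsum_eq]
  refine ((Equiv.prodComm s ι).hasSum_iff.2 h_double.hasSum).prod_fiberwise fun i => ?_
  have h_mixture := ((h.hasSum_apply (b i)).mapL T).mapL (innerSL ℂ (b i))
  simpa [inner_smul_right] using h_mixture

lemma IsMixture.exists_hasExpectation_norm_le {ι : Type*} {ρ : H →L[ℂ] H} {u : ι → H}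
    (h : IsMixture ρ u) {A : H →ₗ.[ℂ] H} {T : H →L[ℂ] H}
    (hA : ∀ x, (ρ x, T (ρ x)) ∈ A.graph) : ∃ z, HasExpectation ρ A z ∧ ‖z‖ ≤ ‖T‖ := by
  choose h_domain h_apply using fun x => exists_apply_eq_of_mem_graph (hA x)
  refine ⟨_, ⟨h_domain, ?_⟩, h.norm_tsum_inner_le T⟩
  simpa only [h_apply] using h.hasTrace T

variable [CompleteSpace H]

lemma exists_symmetric_sqrt {ρ : H →L[ℂ] H} (hρ : ρ.IsPositive) :
    ∃ R : H →L[ℂ] H, (∀ x y, ⟪R x, y⟫_ℂ = ⟪x, R y⟫_ℂ) ∧ ∀ x, R (R x) = ρ x := by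
  have h_nonneg := (ContinuousLinearMap.nonneg_iff_isPositive ρ).2 hρ
  exact ⟨CFC.sqrt ρ, ((ContinuousLinearMap.nonneg_iff_isPositive _).1
    (CFC.sqrt_nonneg ρ)).isSymmetric, DFunLike.congr_fun (CFC.sqrt_mul_sqrt_self ρ h_nonneg)⟩

lemma apply_eq_zero_of_inner_eq_zero {ρ : H →L[ℂ] H} (hρ : ρ.IsPositive) {x : H}
    (hx : ⟪x, ρ x⟫_ℂ = 0) : ρ x = 0 := by
  obtain ⟨R, h_symm, h_sq⟩ := exists_symmetric_sqrt hρ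
  rw [← h_sq, ← h_symm, inner_self_eq_zero] at hx
  rw [← h_sq, hx, map_zero]

lemma exists_isMixture {ρ : H →L[ℂ] H} (hρ : IsDensityMatrix ρ) :
    ∃ (ι : Type) (u : ι → H), IsMixture ρ u := by
  obtain ⟨h_pos, h_trace⟩ := hρ
  obtain ⟨s, b, -⟩ := exists_hilbertBasis ℂ H
  obtain ⟨R, h_symm, h_sq⟩ := exists_symmetric_sqrt h_pos
  refine ⟨s, fun i => R (b i), ?_, fun x => ?_⟩
  · have h_re := (h_trace s b).mapL Complex.reCLM
    simp only [Complex.reCLM_apply, Complex.one_re] at h_re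
    convert! h_re using 2 with i
    rw [← h_sq, ← h_symm]
    exact (inner_self_eq_norm_sq (𝕜 := ℂ) _).symm
  · simpa [b.repr_apply_apply, h_sq, h_symm] using (b.hasSum_repr (R x)).mapL R

end DensityMatrix

section TensorPowerMaps

variable {H : Type} [NormedAddCommGroup H] [InnerProductSpace ℂ H]

lemma dense_span_range_pureTensor : ∀ n : ℕ,
    Dense (Submodule.span ℂ (Set.range (pureTensor (H := H) n)) : Set (TensorPower H n))
  | 0 => by
    intro z
    refine subset_closure ?_
    have h_smul : (show ℂ from z) • pureTensor 0 (![] : Fin 0 → H) = z := mul_one (show ℂ from z)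
    exact h_smul ▸ Submodule.smul_mem _ (show ℂ from z) (Submodule.subset_span ⟨![], rfl⟩)
  | n + 1 => by
    set S := (Submodule.span ℂ (Set.range (pureTensor (H := H) (n + 1)))).topologicalClosure
    have hS : IsClosed (S : Set (TensorPower H (n + 1))) := Submodule.isClosed_topologicalClosure _
    have h_cons (x : H) (y : TensorPower H n) : tensorCons x n y ∈ S := by
      refine mem_of_dense_span (dense_span_range_pureTensor n)
        (S := S.comap (tensorCons x n).toLinearMap) (hS.preimage (tensorCons x n).continuous) ?_ y
      rintro - ⟨z, rfl⟩
      exact Submodule.le_topologicalClosure _ (Submodule.subset_span ⟨Fin.cons x z, rfl⟩)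
    refine mem_of_dense_span (dense_span_range_hilbertTmul ℂ H (TensorPower H n)) hS ?_
    rintro - ⟨⟨x, y⟩, rfl⟩
    exact h_cons x y

lemma continuous_pureTensor : ∀ n : ℕ, Continuous (pureTensor (H := H) n)
  | 0 => continuous_const
  | n + 1 => by
    have h_tail : Continuous fun x : Fin (n + 1) → H => pureTensor n (Fin.tail x) :=
      (continuous_pureTensor n).comp (continuous_pi fun i => continuous_apply i.succ)
    exact ((hilbertTmul ℂ H (TensorPower H n)).continuous.comp (continuous_apply 0)).clm_apply
      h_tail

/-- The operator `A₀ ⊗ ⋯ ⊗ A_{n-1}`. It contains both `tensorMap` and the bounded one-site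
operators as special cases, so that they can be composed factor by factor. -/
def productMap : (n : ℕ) → (Fin n → H →L[ℂ] H) → (TensorPower H n →L[ℂ] TensorPower H n)
  | 0, _ => ContinuousLinearMap.id ℂ _
  | n + 1, A => (TensorProduct.mapL (A 0) (productMap n (Fin.tail A))).completion

lemma productMap_pureTensor : ∀ (n : ℕ) (A : Fin n → H →L[ℂ] H) (x : Fin n → H),
    productMap n A (pureTensor n x) = pureTensor n fun i => A i (x i)
  | 0, _, _ => rfl
  | n + 1, A, x => by
    refine (completion_mapL_hilbertTmul (A 0) (productMap n (Fin.tail A)) (x 0)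
      (pureTensor n (Fin.tail x))).trans ?_
    rw [productMap_pureTensor n]
    rfl

lemma norm_productMap_le : ∀ (n : ℕ) (A : Fin n → H →L[ℂ] H), ‖productMap n A‖ ≤ ∏ i, ‖A i‖
  | 0, _ => by
    rw [Finset.univ_eq_empty, Finset.prod_empty]
    exact ContinuousLinearMap.norm_id_le
  | n + 1, A => by
    rw [Fin.prod_univ_succ]
    calc ‖productMap (n + 1) A‖
        ≤ ‖TensorProduct.mapL (A 0) (productMap n (Fin.tail A))‖ := norm_completion_le _
      _ ≤ ‖A 0‖ * ‖productMap n (Fin.tail A)‖ := TensorProduct.norm_mapL_le _ _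
      _ ≤ ‖A 0‖ * ∏ i, ‖Fin.tail A i‖ := by gcongr; exact norm_productMap_le n _

lemma productMap_comp_productMap (n : ℕ) (A B : Fin n → H →L[ℂ] H) :
    (productMap n A).comp (productMap n B) = productMap n fun i => (A i).comp (B i) := by
  refine ContinuousLinearMap.ext_on (dense_span_range_pureTensor n) ?_
  rintro - ⟨x, rfl⟩
  simp only [ContinuousLinearMap.comp_apply, productMap_pureTensor]

lemma productMap_const (A : H →L[ℂ] H) : ∀ n : ℕ, productMap n (fun _ => A) = tensorMap A n
  | 0 => rfl
  | n + 1 => congrArg (fun B => (TensorProduct.mapL A B).completion) (productMap_const A n)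

lemma norm_tensorMap_le (A : H →L[ℂ] H) (n : ℕ) : ‖tensorMap A n‖ ≤ ‖A‖ ^ n := by
  simpa only [productMap_const, Finset.prod_const, Finset.card_univ, Fintype.card_fin] using
    norm_productMap_le n fun _ => A

lemma tensorMap_comp_tensorMap (A B : H →L[ℂ] H) (n : ℕ) :
    (tensorMap A n).comp (tensorMap B n) = tensorMap (A.comp B) n := by
  simp only [← productMap_const, productMap_comp_productMap]

lemma IsMixture.tensorMap {ι : Type} {ρ : H →L[ℂ] H} {u : ι → H} (h : IsMixture ρ u) :
    ∀ n : ℕ, ∃ (κ : Type) (w : κ → TensorPower H n), IsMixture (tensorMap ρ n) w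
  | 0 => ⟨Unit, _, isMixture_id ℂ⟩
  | n + 1 =>
    let ⟨κ, _, hw⟩ := h.tensorMap n
    ⟨ι × κ, _, h.tensor hw⟩

/-- The bounded operator `A` acting on the `m`-th tensor factor, the counterpart of `siteOp`. -/
def siteMap (A : H →L[ℂ] H) {n : ℕ} (m : Fin n) : TensorPower H n →L[ℂ] TensorPower H n :=
  productMap n (Function.update (fun _ => ContinuousLinearMap.id ℂ H) m A)

lemma siteMap_pureTensor (A : H →L[ℂ] H) {n : ℕ} (m : Fin n) (x : Fin n → H) :
    siteMap A m (pureTensor n x) = pureTensor n (Function.update x m (A (x m))) := by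
  rw [siteMap, productMap_pureTensor]
  congr 1
  ext i
  rcases eq_or_ne i m with rfl | hi
  · simp only [Function.update_self]
  · simp only [Function.update_of_ne hi, ContinuousLinearMap.id_apply]

lemma norm_siteMap_le (A : H →L[ℂ] H) {n : ℕ} (m : Fin n) : ‖siteMap A m‖ ≤ ‖A‖ := by
  refine (norm_productMap_le _ _).trans ?_
  rw [← Finset.mul_prod_erase _ _ (Finset.mem_univ m), Function.update_self]
  refine mul_le_of_le_one_right (norm_nonneg _) (Finset.prod_le_one (fun _ _ => norm_nonneg _) ?_)
  intro i hi
  rw [Function.update_of_ne (Finset.ne_of_mem_erase hi)]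
  exact ContinuousLinearMap.norm_id_le

lemma siteMap_comp_tensorMap (A B : H →L[ℂ] H) {n : ℕ} (m : Fin n) :
    (siteMap A m).comp (tensorMap B n) =
      productMap n (Function.update (fun _ => B) m (A.comp B)) := by
  rw [← productMap_const, siteMap, productMap_comp_productMap]
  congr 1
  ext1 i
  rcases eq_or_ne i m with rfl | hi
  · simp only [Function.update_self]
  · simp only [Function.update_of_ne hi, ContinuousLinearMap.id_comp]

lemma tensorMap_comp_siteMap (A B : H →L[ℂ] H) {n : ℕ} (m : Fin n) :
    (tensorMap B n).comp (siteMap A m) =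
      productMap n (Function.update (fun _ => B) m (B.comp A)) := by
  rw [← productMap_const, siteMap, productMap_comp_productMap]
  congr 1
  ext1 i
  rcases eq_or_ne i m with rfl | hi
  · simp only [Function.update_self]
  · simp only [Function.update_of_ne hi, ContinuousLinearMap.comp_id]

lemma siteMap_comp_tensorMap_of_comp_eq {A B : H →L[ℂ] H} (h : A.comp B = B) {n : ℕ}
    (m : Fin n) : (siteMap A m).comp (tensorMap B n) = tensorMap B n := by
  rw [siteMap_comp_tensorMap, h, Function.update_eq_self_iff.2 rfl, productMap_const]

lemma tensorMap_comp_siteMap_of_comm {A B : H →L[ℂ] H} (h : B.comp A = A.comp B) {n : ℕ}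
    (m : Fin n) : (tensorMap B n).comp (siteMap A m) = (siteMap A m).comp (tensorMap B n) := by
  rw [tensorMap_comp_siteMap, siteMap_comp_tensorMap, h]

lemma tendsto_siteMap {ι : Type*} {l : Filter ι} {P : ι → H →L[ℂ] H} (hP : ∀ i, ‖P i‖ ≤ 1)
    (hlim : ∀ x, Filter.Tendsto (fun i => P i x) l (nhds x)) {n : ℕ} (m : Fin n)
    (ψ : TensorPower H n) : Filter.Tendsto (fun i => siteMap (P i) m ψ) l (nhds ψ) := by
  refine tendsto_apply_of_dense_span (L := ContinuousLinearMap.id ℂ _) (C := 1)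
    (fun i => (norm_siteMap_le _ m).trans (hP i)) (dense_span_range_pureTensor n) ?_ ψ
  rintro - ⟨x, rfl⟩
  have h_update := tendsto_const_nhds.update (f := fun _ => x) m (hlim (x m))
  rw [Function.update_eq_self] at h_update
  simp only [siteMap_pureTensor]
  exact ((continuous_pureTensor n).tendsto x).comp h_update

end TensorPowerMaps

section SiteOp

variable {H : Type} [NormedAddCommGroup H] [InnerProductSpace ℂ H]

/-- The linear relation on pure tensors that applies `A` to the `m`-th factor. The graph of `siteOp`
is its closure, as soon as that closure is single-valued. -/
def siteGraph (A : H →ₗ.[ℂ] H) {n : ℕ} (m : Fin n) :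
    Submodule ℂ (TensorPower H n × TensorPower H n) :=
  Submodule.span ℂ {p | ∃ (x : Fin n → H) (h : x m ∈ A.domain),
    p = (pureTensor n x, pureTensor n (Function.update x m (A ⟨x m, h⟩)))}

variable {A : H →ₗ.[ℂ] H} {n : ℕ} {m : Fin n}

lemma siteMap_snd_eq_of_mem_closure_siteGraph {P W : H →L[ℂ] H}
    (h : ∀ x y, (x, y) ∈ A.graph → P y = W x) {p : TensorPower H n × TensorPower H n}
    (hp : p ∈ (siteGraph A m).topologicalClosure) : siteMap P m p.2 = siteMap W m p.1 := by
  set S : Submodule ℂ (TensorPower H n × TensorPower H n) := LinearMap.eqLocus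
    ((siteMap P m).comp (ContinuousLinearMap.snd ℂ _ _)).toLinearMap
    ((siteMap W m).comp (ContinuousLinearMap.fst ℂ _ _)).toLinearMap
  suffices (siteGraph A m).topologicalClosure ≤ S from this hp
  refine Submodule.topologicalClosure_minimal _ (Submodule.span_le.2 ?_)
    (isClosed_eq (ContinuousLinearMap.continuous _) (ContinuousLinearMap.continuous _))
  rintro - ⟨x, hx, rfl⟩
  change siteMap P m (pureTensor n _) = siteMap W m (pureTensor n _)
  rw [siteMap_pureTensor, siteMap_pureTensor, Function.update_self, Function.update_idem,
    h _ _ (A.mem_graph ⟨x m, hx⟩)]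

lemma mem_closure_siteGraph {P W : H →L[ℂ] H} (h : ∀ x, (P x, W x) ∈ A.graph)
    (ψ : TensorPower H n) :
    (siteMap P m ψ, siteMap W m ψ) ∈ (siteGraph A m).topologicalClosure := by
  set f := (siteMap P m).prod (siteMap W m)
  refine mem_of_dense_span (dense_span_range_pureTensor n)
    (S := (siteGraph A m).topologicalClosure.comap f.toLinearMap)
    ((siteGraph A m).isClosed_topologicalClosure.preimage f.continuous) ?_ ψ
  rintro - ⟨x, rfl⟩
  obtain ⟨hx, hAx⟩ := exists_apply_eq_of_mem_graph (h (x m))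
  refine Submodule.le_topologicalClosure _ (Submodule.subset_span
    ⟨Function.update x m (P (x m)), by rwa [Function.update_self], ?_⟩)
  change (siteMap P m (pureTensor n x), siteMap W m (pureTensor n x)) = _
  rw [siteMap_pureTensor, siteMap_pureTensor, Function.update_idem]
  simp only [Function.update_self, hAx]

/-- Cutoffs for an unbounded operator `A`: idempotent contractions `P k` that tend strongly to the
identity, such that `A (P k)` and `(P k) A` are both given by the bounded operator `W k`. They show
that `A`, and likewise each `A^{[m]}`, is closable and bounded on the range of a cutoff. -/
structure IsCutoff (A : H →ₗ.[ℂ] H) (P W : ℕ → H →L[ℂ] H) : Prop where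
  comp_self : ∀ k, (P k).comp (P k) = P k
  norm_le : ∀ k, ‖P k‖ ≤ 1
  tendsto : ∀ x, Filter.Tendsto (fun k => P k x) Filter.atTop (nhds x)
  mem_graph : ∀ k x, (P k x, W k x) ∈ A.graph
  apply_eq : ∀ k x y, (x, y) ∈ A.graph → P k y = W k x

namespace IsCutoff

variable {P W : ℕ → H →L[ℂ] H}

lemma graph_siteOp (h : IsCutoff A P W) (m : Fin n) :
    (siteOp A m).graph = (siteGraph A m).topologicalClosure := by
  refine Submodule.toLinearPMap_graph_eq _ fun p hp hp₁ => ?_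
  refine tendsto_nhds_unique (tendsto_siteMap h.norm_le h.tendsto m p.2) ?_
  simp only [siteMap_snd_eq_of_mem_closure_siteGraph (h.apply_eq _) hp, hp₁, map_zero]
  exact tendsto_const_nhds

lemma mem_graph_siteOp (h : IsCutoff A P W) (m : Fin n) (k : ℕ) (ψ : TensorPower H n) :
    (siteMap (P k) m ψ, siteMap (W k) m ψ) ∈ (siteOp A m).graph := by
  rw [h.graph_siteOp]
  exact mem_closure_siteGraph (h.mem_graph k) ψ

lemma comp_comm (h : IsCutoff A P W) (k : ℕ) : (P k).comp (W k) = (W k).comp (P k) :=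
  ContinuousLinearMap.ext fun x => h.apply_eq k _ _ (h.mem_graph k x)

end IsCutoff

/-- The bounded mean field operator `M⁻¹ ∑_m W^{[m]}`, the counterpart of `meanField`. -/
def meanMap (W : H →L[ℂ] H) (M : ℕ) : TensorPower H M →L[ℂ] TensorPower H M :=
  (M : ℂ)⁻¹ • ∑ m : Fin M, siteMap W m

lemma norm_meanMap_le (W : H →L[ℂ] H) (M : ℕ) : ‖meanMap W M‖ ≤ ‖W‖ := by
  have h_sum : ‖∑ m : Fin M, siteMap W m‖ ≤ M * ‖W‖ := by
    simpa using norm_sum_le_of_le Finset.univ fun (m : Fin M) _ => norm_siteMap_le W m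
  rw [meanMap, norm_smul, norm_inv, Complex.norm_natCast]
  exact inv_mul_le_of_le_mul₀ (Nat.cast_nonneg M) (norm_nonneg W) h_sum

lemma tensorMap_comp_meanMap_of_comm {P W : H →L[ℂ] H} (h : P.comp W = W.comp P) (M : ℕ) :
    (tensorMap P M).comp (meanMap W M) = (meanMap W M).comp (tensorMap P M) := by
  simp only [meanMap, ContinuousLinearMap.comp_smul, ContinuousLinearMap.smul_comp,
    ContinuousLinearMap.comp_finsetSum, ContinuousLinearMap.finsetSum_comp,
    tensorMap_comp_siteMap_of_comm h]

lemma IsCutoff.mem_graph_meanField {P W : ℕ → H →L[ℂ] H} (h : IsCutoff A P W) (k : ℕ) {M : ℕ}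
    {ψ : TensorPower H M} (hψ : tensorMap (P k) M ψ = ψ) :
    (ψ, meanMap (W k) M ψ) ∈ (meanField A M).graph := by
  have h_site (m : Fin M) : (ψ, siteMap (W k) m ψ) ∈ (siteOp A m).graph := by
    have h_fix : siteMap (P k) m ψ = ψ := by
      simpa only [ContinuousLinearMap.comp_apply, hψ] using
        DFunLike.congr_fun (siteMap_comp_tensorMap_of_comp_eq (h.comp_self k) m) ψ
    simpa only [h_fix] using h.mem_graph_siteOp m k ψ
  simpa [meanMap, meanField] using
    mem_graph_smul (M : ℂ)⁻¹ (mem_graph_sum Finset.univ fun m _ => h_site m)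

lemma reservoirBound_of_isCutoff [CompleteSpace H] {ρ : H →L[ℂ] H} (hρ : IsDensityMatrix ρ)
    {v : ℝ → H →ₗ.[ℂ] H} {P : ℕ → H →L[ℂ] H} {W : ℝ → ℕ → H →L[ℂ] H}
    (hv : ∀ t, IsCutoff (v t) P (W t)) {k : ℕ} (hPρ : (P k).comp ρ = ρ) {C : ℝ}
    (hW : ∀ t, ‖W t k‖ ≤ C) :
    ReservoirBound (fun M => tensorMap ρ M) v (fun n => C ^ n) fun _ => 1 := by
  intro n t _ M _
  obtain ⟨ι, u, hu⟩ := exists_isMixture hρ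
  obtain ⟨κ, w, hw⟩ := hu.tensorMap M
  set T : Fin n → (TensorPower H M →L[ℂ] TensorPower H M) := fun i => meanMap (W (t i) k) M
  have h_graph : ∀ ψ, tensorMap (P k) M ψ = ψ →
      (ψ, (List.ofFn T).prod ψ) ∈ (opProd (List.ofFn fun i => meanField (v (t i)) M)).graph :=
    fun ψ hψ => (mem_graph_opProd_ofFn (S := {ψ | tensorMap (P k) M ψ = ψ})
      (fun i ψ hψ => (hv (t i)).mem_graph_meanField k hψ)
      (fun i ψ hψ => (DFunLike.congr_fun (tensorMap_comp_meanMap_of_comm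
        ((hv (t i)).comp_comm k) M) ψ).trans (congrArg (T i) hψ)) ψ hψ).1
  have h_fix : (tensorMap (P k) M).comp (tensorMap ρ M) = tensorMap ρ M := by
    rw [tensorMap_comp_tensorMap, hPρ]
  obtain ⟨z, hz, h_norm⟩ := hw.exists_hasExpectation_norm_le fun ψ =>
    h_graph _ (DFunLike.congr_fun h_fix ψ)
  have hT : ∀ a ∈ List.ofFn T, ‖a‖ ≤ C :=
    List.forall_mem_ofFn_iff.2 fun i => (norm_meanMap_le _ M).trans (hW (t i))
  have hC : 0 ≤ C := (norm_nonneg _).trans (hW 0)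
  have h_prod := norm_list_prod_le_pow ContinuousLinearMap.norm_id_le hC hT
  rw [List.length_ofFn] at h_prod
  exact ⟨z, hz, by simpa only [Finset.prod_const_one, mul_one] using h_norm.trans h_prod⟩

end SiteOp

section Cutoff

open scoped ENNReal

variable {𝕜 : Type*} [NontriviallyNormedField 𝕜] {E : ℕ → Type*} [∀ n, NormedAddCommGroup (E n)]
  [∀ n, NormedSpace 𝕜 (E n)]

lemma norm_ite_le_sum (B : ∀ n, E n →L[𝕜] E n) (k n : ℕ) :
    ‖(if n ≤ k then B n else 0)‖ ≤ ∑ j ∈ Finset.range (k + 1), ‖B j‖ := by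
  split_ifs with hn
  · exact Finset.single_le_sum (f := fun j => ‖B j‖) (fun _ _ => norm_nonneg _)
      (Finset.mem_range_succ_iff.2 hn)
  · simpa only [norm_zero] using Finset.sum_nonneg fun j _ => norm_nonneg (B j)

variable (p : ℝ≥0∞) [Fact (1 ≤ p)]

/-- The block diagonal operator on the `ℓᵖ`-sum of the `E n` with blocks `B 0, …, B k` and all
further blocks zero. It is bounded whatever the blocks are. -/
def cutoff (B : ∀ n, E n →L[𝕜] E n) (k : ℕ) : lp E p →L[𝕜] lp E p :=
  lp.mapCLM p (fun n => if n ≤ k then B n else 0)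
    (Finset.sum_nonneg fun j _ => norm_nonneg (B j)) (norm_ite_le_sum B k)

variable {p}

lemma cutoff_apply (B : ∀ n, E n →L[𝕜] E n) (k : ℕ) (x : lp E p) (n : ℕ) :
    cutoff p B k x n = if n ≤ k then B n (x n) else 0 := by
  change (if n ≤ k then B n else 0) (x n) = _
  split_ifs <;> rfl

lemma norm_cutoff_le {B : ∀ n, E n →L[𝕜] E n} {k : ℕ} {C : ℝ} (hB : ∀ n ≤ k, ‖B n‖ ≤ C) :
    ‖cutoff p B k‖ ≤ C := by
  have hC : 0 ≤ C := (norm_nonneg _).trans (hB 0 k.zero_le)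
  refine lp.norm_mapCLM_le p (K := C) (fun n => if n ≤ k then B n else 0) hC fun n => ?_
  split_ifs with hn
  · exact hB n hn
  · simpa only [norm_zero] using hC

lemma cutoff_comp_cutoff (A B : ∀ n, E n →L[𝕜] E n) (k : ℕ) :
    (cutoff p A k).comp (cutoff p B k) = cutoff p (fun n => (A n).comp (B n)) k := by
  ext x n
  simp only [ContinuousLinearMap.comp_apply, cutoff_apply]
  split_ifs <;> rfl

lemma tendsto_cutoff_id (hp : p ≠ ⊤) (x : lp E p) :
    Filter.Tendsto (fun k => cutoff p (fun n => ContinuousLinearMap.id 𝕜 (E n)) k x) Filter.atTop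
      (nhds x) := by
  have h_sum (k : ℕ) : cutoff p (fun n => ContinuousLinearMap.id 𝕜 (E n)) k x =
      ∑ j ∈ Finset.range (k + 1), lp.single p j (x j) := by
    ext n
    rw [cutoff_apply, lp.coeFn_sum, Finset.sum_apply]
    simp only [lp.coeFn_single, Finset.sum_pi_single, Finset.mem_range_succ_iff,
      ContinuousLinearMap.id_apply]
  simp only [h_sum]
  exact (lp.hasSum_single hp x).tendsto_sum_nat.comp (Filter.tendsto_add_atTop_nat 1)

end Cutoff

section BlockDiagonal

variable {E : ℕ → Type} [∀ n, NormedAddCommGroup (E n)] [∀ n, InnerProductSpace ℂ (E n)]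

/-- The unbounded operator `A` on the Hilbert sum of the `E n` acts by the bounded operator `B n` on
the `n`-th summand, and all vectors with finitely many components lie in its domain. -/
structure IsBlockDiagonal (A : lp E 2 →ₗ.[ℂ] lp E 2) (B : ∀ n, E n →L[ℂ] E n) : Prop where
  apply_eq : ∀ {x y}, (x, y) ∈ A.graph → ∀ n, y n = B n (x n)
  mem_graph : ∀ {x y} {k : ℕ}, (∀ n, k < n → x n = 0) → (∀ n, y n = B n (x n)) → (x, y) ∈ A.graph

namespace IsBlockDiagonal

variable {A A' : lp E 2 →ₗ.[ℂ] lp E 2} {B B' : ∀ n, E n →L[ℂ] E n}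

lemma opMul (h' : IsBlockDiagonal A' B') (h : IsBlockDiagonal A B) :
    IsBlockDiagonal (opMul A' A) fun n => (B' n).comp (B n) where
  apply_eq hxy n := by
    obtain ⟨z, hxz, hzy⟩ := mem_graph_opMul.1 hxy
    rw [h'.apply_eq hzy, h.apply_eq hxz, ContinuousLinearMap.comp_apply]
  mem_graph {x y k} hx hy := by
    have hz (n : ℕ) : cutoff 2 B k x n = B n (x n) := by
      rw [cutoff_apply, ite_eq_left_iff, not_le]
      intro hn
      rw [hx n hn, map_zero]
    refine mem_graph_opMul.2 ⟨cutoff 2 B k x, h.mem_graph hx hz,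
      h'.mem_graph (k := k) (fun n hn => ?_) fun n => ?_⟩
    · rw [hz, hx n hn, map_zero]
    · rw [hz, hy, ContinuousLinearMap.comp_apply]

lemma isCutoff (h : IsBlockDiagonal A B) :
    IsCutoff A (cutoff 2 fun n => ContinuousLinearMap.id ℂ (E n)) (cutoff 2 B) where
  comp_self k := cutoff_comp_cutoff _ _ k
  norm_le _ := norm_cutoff_le fun _ _ => ContinuousLinearMap.norm_id_le
  tendsto := tendsto_cutoff_id ENNReal.ofNat_ne_top
  mem_graph k x := by
    refine h.mem_graph (k := k) (fun n hn => ?_) fun n => ?_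
    · rw [cutoff_apply, if_neg hn.not_ge]
    · simp only [cutoff_apply]
      split_ifs
      · rfl
      · rw [map_zero]
  apply_eq k x y hxy := by
    ext n
    rw [cutoff_apply, cutoff_apply, ContinuousLinearMap.id_apply, h.apply_eq hxy]

end IsBlockDiagonal

end BlockDiagonal

section FockOperators

variable {h : Type} [NormedAddCommGroup h] [InnerProductSpace ℂ h]

lemma mem_graph_maxOp {L : (∀ n, Sector h n) →ₗ[ℂ] (∀ n, Sector h n)} {x y : Fock h} :
    (x, y) ∈ (maxOp L).graph ↔ ∀ n, y n = L x n := by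
  constructor
  · intro hxy n
    obtain ⟨hx, rfl⟩ := exists_apply_eq_of_mem_graph hxy
    rfl
  · intro hy
    have hL : L x = y := funext fun n => (hy n).symm
    have hx : Memℓp (L x) 2 := hL ▸ lp.memℓp y
    have hy : maxOp L ⟨x, hx⟩ = y := Subtype.ext hL
    exact hy ▸ (maxOp L).mem_graph ⟨x, hx⟩

lemma mem_graph_number {x y : Fock h} :
    (x, y) ∈ (number : Fock h →ₗ.[ℂ] Fock h).graph ↔ ∀ n, y n = (n : ℂ) • x n :=
  mem_graph_maxOp

lemma apply_eq_of_mem_graph_opPow_number {k : ℕ} {x y : Fock h}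
    (hxy : (x, y) ∈ (opPow number k).graph) (n : ℕ) : y n = (n : ℂ) ^ k • x n := by
  induction k generalizing y with
  | zero => rw [mem_graph_opOne.1 hxy, pow_zero, one_smul]
  | succ k ih =>
    obtain ⟨z, hxz, hzy⟩ := mem_graph_opMul.1 hxy
    rw [mem_graph_number.1 hzy, ih hxz, smul_smul, pow_succ']

lemma mem_graph_number_add_one {x y : Fock h} :
    (x, y) ∈ (number + opOne : Fock h →ₗ.[ℂ] Fock h).graph ↔ ∀ n, y n = ((n : ℂ) + 1) • x n := by
  simp only [add_smul, one_smul]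
  constructor
  · intro hxy n
    obtain ⟨⟨hx, -⟩, rfl⟩ := exists_apply_eq_of_mem_graph hxy
    exact congrArg (· + x n) (mem_graph_number.1 (number.mem_graph ⟨x, hx⟩) n)
  · intro hy
    have h_number : (x, y - x) ∈ (number : Fock h →ₗ.[ℂ] Fock h).graph :=
      mem_graph_number.2 fun n => by
        rw [lp.coeFn_sub, Pi.sub_apply, hy, add_sub_cancel_right]
    simpa only [sub_add_cancel] using mem_graph_add h_number (mem_graph_opOne.2 rfl)

lemma mem_graph_inverse_number_add_one {x y : Fock h} :
    (y, x) ∈ (number + opOne : Fock h →ₗ.[ℂ] Fock h).inverse.graph ↔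
      ∀ n, y n = ((n : ℂ) + 1) • x n := by
  refine (mem_graph_inverse fun x hx => ?_).trans mem_graph_number_add_one
  ext n : 2
  exact (smul_eq_zero.1 (mem_graph_number_add_one.1 hx n).symm).resolve_left
    (Nat.cast_add_one_ne_zero n)

lemma mem_graph_create {f : h} {x y : Fock h} :
    (x, y) ∈ (create f).graph ↔ y 0 = 0 ∧ ∀ n, y (n + 1) = createSector f n (x n) :=
  mem_graph_maxOp.trans ⟨fun hy => ⟨hy 0, fun n => hy (n + 1)⟩, fun hy n => match n with
    | 0 => hy.1
    | n + 1 => hy.2 n⟩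

lemma mem_graph_annihilate {f : h} {x y : Fock h} :
    (x, y) ∈ (annihilate f).graph ↔ ∀ n, y n = annihilateSector f n (x (n + 1)) :=
  mem_graph_maxOp

lemma norm_createSector_le (f : h) (n : ℕ) : ‖createSector f n‖ ≤ √(n + 1) * ‖f‖ := by
  refine ContinuousLinearMap.opNorm_le_bound _ (by positivity) fun ψ => ?_
  have h_tensor : ‖tensorCons f n ψ‖ = ‖f‖ * ‖ψ‖ := norm_hilbertTmul f ψ.1
  calc ‖createSector f n ψ‖
      = √(n + 1) * ‖(symSubspace h (n + 1)).orthogonalProjectionOnto (tensorCons f n ψ)‖ := by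
        change ‖((√(n + 1) : ℝ) : ℂ) •
          (symSubspace h (n + 1)).orthogonalProjectionOnto (tensorCons f n ψ)‖ = _
        rw [norm_smul, Complex.norm_real, Real.norm_of_nonneg (Real.sqrt_nonneg _)]
    _ ≤ √(n + 1) * ‖tensorCons f n ψ‖ := by
        gcongr
        exact (symSubspace h (n + 1)).norm_orthogonalProjectionOnto_apply_le _
    _ = √(n + 1) * ‖f‖ * ‖ψ‖ := by rw [h_tensor, mul_assoc]

lemma norm_annihilateSector_le (f : h) (n : ℕ) : ‖annihilateSector f n‖ ≤ √(n + 1) * ‖f‖ := by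
  rw [annihilateSector, LinearIsometryEquiv.norm_map]
  exact norm_createSector_le f n

/-- The restriction of `a†(g) a(g)` to the `n`-particle space. -/
def scatteringSector (g : h) : (n : ℕ) → Sector h n →L[ℂ] Sector h n
  | 0 => 0
  | n + 1 => (createSector g n).comp (annihilateSector g n)

lemma norm_scatteringSector_le (g : h) : ∀ n : ℕ, ‖scatteringSector g n‖ ≤ n * ‖g‖ ^ 2
  | 0 => by
    rw [Nat.cast_zero, zero_mul]
    exact (ContinuousLinearMap.opNorm_zero (E := Sector h 0) (F := Sector h 0)).le
  | n + 1 =>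
    calc ‖(createSector g n).comp (annihilateSector g n)‖
        ≤ ‖createSector g n‖ * ‖annihilateSector g n‖ := ContinuousLinearMap.opNorm_comp_le _ _
      _ ≤ (√(n + 1) * ‖g‖) * (√(n + 1) * ‖g‖) := by
        gcongr
        · exact norm_createSector_le g n
        · exact norm_annihilateSector_le g n
      _ = √(n + 1) ^ 2 * ‖g‖ ^ 2 := by ring
      _ = (n + 1 : ℕ) * ‖g‖ ^ 2 := by rw [Real.sq_sqrt (by positivity), Nat.cast_succ]

lemma memℓp_annihilateSector {x y : Fock h}
    (hxy : (x, y) ∈ (number : Fock h →ₗ.[ℂ] Fock h).graph) (f : h) :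
    Memℓp (fun n => annihilateSector f n (x (n + 1))) 2 := by
  have h_bound (n : ℕ) : ‖annihilateSector f n (x (n + 1))‖ ≤ ‖f‖ * ‖y (n + 1)‖ :=
    calc ‖annihilateSector f n (x (n + 1))‖
        ≤ √(n + 1) * ‖f‖ * ‖x (n + 1)‖ :=
          (annihilateSector f n).le_of_opNorm_le (norm_annihilateSector_le f n) _
      _ ≤ (n + 1) * ‖f‖ * ‖x (n + 1)‖ := by
          gcongr
          exact Real.sqrt_le_self_iff.2 (.inr (le_add_of_nonneg_left n.cast_nonneg))
      _ = ‖f‖ * ‖y (n + 1)‖ := by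
          rw [mem_graph_number.1 hxy, norm_smul, Complex.norm_natCast, Nat.cast_succ]
          ring
  have h_shift : Memℓp (fun n => ‖y (n + 1)‖) 2 := by
    refine memℓp_gen ?_
    simpa only [norm_norm, Function.comp_def] using
      ((lp.memℓp y).summable (by norm_num)).comp_injective (add_left_injective 1)
  exact (h_shift.const_mul ‖f‖).mono h_bound

lemma apply_eq_of_mem_graph_scattering {g : h} {x y : Fock h}
    (hxy : (x, y) ∈ (scattering g).graph) (n : ℕ) : y n = scatteringSector g n (x n) := by
  obtain ⟨z, hxz, hzy⟩ := mem_graph_opMul.1 hxy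
  obtain ⟨hy_zero, hy_succ⟩ := mem_graph_create.1 hzy
  cases n with
  | zero => exact hy_zero
  | succ n => exact (hy_succ n).trans (congrArg _ (mem_graph_annihilate.1 hxz n))

lemma mem_graph_scattering {g : h} {x y : Fock h}
    (hx : x ∈ (number : Fock h →ₗ.[ℂ] Fock h).domain)
    (hy : ∀ n, y n = scatteringSector g n (x n)) : (x, y) ∈ (scattering g).graph :=
  mem_graph_opMul.2 ⟨⟨_, memℓp_annihilateSector (number.mem_graph ⟨x, hx⟩) g⟩,
    mem_graph_annihilate.2 fun _ => rfl, mem_graph_create.2 ⟨hy 0, fun n => hy (n + 1)⟩⟩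

lemma isBlockDiagonal_maxOp (B : ∀ n, Sector h n →L[ℂ] Sector h n) :
    IsBlockDiagonal (maxOp (LinearMap.pi fun n => (B n).toLinearMap ∘ₗ LinearMap.proj n)) B where
  apply_eq hxy := mem_graph_maxOp.1 hxy
  mem_graph _ hy := mem_graph_maxOp.2 hy

lemma isBlockDiagonal_scattering (g : h) : IsBlockDiagonal (scattering g) (scatteringSector g) where
  apply_eq := apply_eq_of_mem_graph_scattering
  mem_graph {x y k} hx hy := by
    refine mem_graph_scattering (exists_apply_eq_of_mem_graph (mem_graph_number
      (y := cutoff 2 (fun n => (n : ℂ) • ContinuousLinearMap.id ℂ (Sector h n)) k x) |>.2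
      fun n => ?_)).1 hy
    rw [cutoff_apply]
    split_ifs with hn
    · rfl
    · rw [hx n (not_le.1 hn), smul_zero]

lemma norm_inv_natCast_add_one_smul_le {E F : Type*} [NormedAddCommGroup E] [NormedSpace ℂ E]
    [NormedAddCommGroup F] [NormedSpace ℂ F] {T : E →L[ℂ] F} {n : ℕ} {C : ℝ}
    (hT : ‖T‖ ≤ (n + 1) * C) : ‖((n : ℂ) + 1)⁻¹ • T‖ ≤ C := by
  have h_norm : ‖(n : ℂ) + 1‖ = n + 1 := by exact_mod_cast Complex.norm_natCast (n + 1)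
  rwa [norm_smul, norm_inv, h_norm, inv_mul_le_iff₀ (by positivity)]

theorem isBoundedBy_scattering_inverse_number_add_one (g : h) :
    IsBoundedBy (opMul (scattering g) (number + opOne : Fock h →ₗ.[ℂ] Fock h).inverse)
      (‖g‖ ^ 2) := by
  intro ψ
  have h_id (n : ℕ) : ‖ContinuousLinearMap.id ℂ (Sector h n)‖ ≤ (n + 1) * 1 := by
    rw [mul_one]
    exact ContinuousLinearMap.norm_id_le.trans (le_add_of_nonneg_left n.cast_nonneg)
  have h_scattering (n : ℕ) : ‖scatteringSector g n‖ ≤ (n + 1) * ‖g‖ ^ 2 :=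
    (norm_scatteringSector_le g n).trans (by gcongr; exact le_add_of_nonneg_right zero_le_one)
  set R : Fock h →L[ℂ] Fock h :=
    lp.mapCLM 2 _ zero_le_one fun n => norm_inv_natCast_add_one_smul_le (h_id n)
  set T : Fock h →L[ℂ] Fock h :=
    lp.mapCLM 2 _ (sq_nonneg ‖g‖) fun n => norm_inv_natCast_add_one_smul_le (h_scattering n)
  have hR (n : ℕ) : ψ n = ((n : ℂ) + 1) • R ψ n :=
    (smul_inv_smul₀ (Nat.cast_add_one_ne_zero n) (ψ n)).symm
  have hT (n : ℕ) : T ψ n = scatteringSector g n (R ψ n) :=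
    ((scatteringSector g n).map_smul _ (ψ n)).symm
  obtain ⟨⟨hRψ, -⟩, -⟩ := exists_apply_eq_of_mem_graph (mem_graph_number_add_one.2 hR)
  obtain ⟨hψ, h_apply⟩ := exists_apply_eq_of_mem_graph (mem_graph_opMul.2
    ⟨R ψ, mem_graph_inverse_number_add_one.2 hR, mem_graph_scattering hRψ hT⟩)
  exact ⟨hψ, h_apply ▸ T.le_of_opNorm_le (lp.norm_mapCLM_le 2 _ _ _) ψ⟩

lemma norm_comp_scatteringSector_comp_le {n : ℕ} {A B : Sector h n →L[ℂ] Sector h n}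
    (hA : ‖A‖ ≤ 1) (hB : ‖B‖ ≤ 1) (g : h) :
    ‖A.comp ((scatteringSector g n).comp B)‖ ≤ n * ‖g‖ ^ 2 :=
  calc ‖A.comp ((scatteringSector g n).comp B)‖
      ≤ ‖A‖ * (‖scatteringSector g n‖ * ‖B‖) :=
        (ContinuousLinearMap.opNorm_comp_le _ _).trans (by
          gcongr
          exact ContinuousLinearMap.opNorm_comp_le _ _)
    _ ≤ 1 * (n * ‖g‖ ^ 2 * 1) := by
        gcongr
        exact norm_scatteringSector_le g n
    _ = n * ‖g‖ ^ 2 := by ring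

/-- The restriction of `Γ(U)` to the `n`-particle space. -/
def quantizationSector (U : h →L[ℂ] h) (n : ℕ) : Sector h n →L[ℂ] Sector h n :=
  ((symSubspace h n).orthogonalProjectionOnto.comp (tensorMap U n)).comp (symSubspace h n).subtypeL

lemma isBlockDiagonal_secondQuantization (U : h →L[ℂ] h) :
    IsBlockDiagonal (secondQuantization U) (quantizationSector U) :=
  isBlockDiagonal_maxOp _

lemma norm_quantizationSector_le (U : h →L[ℂ] h) (n : ℕ) : ‖quantizationSector U n‖ ≤ ‖U‖ ^ n :=
  ContinuousLinearMap.opNorm_le_bound _ (by positivity) fun ψ =>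
    ((symSubspace h n).norm_orthogonalProjectionOnto_apply_le _).trans
      ((tensorMap U n).le_of_opNorm_le (norm_tensorMap_le U n) ψ.1)

end FockOperators

section Support

variable {ι 𝕜 : Type*} [RCLike 𝕜] [DecidableEq ι] {E : ι → Type*} [∀ i, NormedAddCommGroup (E i)]
  [∀ i, InnerProductSpace 𝕜 (E i)]

lemma orthonormal_single {w : ι → Type*} {e : ∀ i, w i → E i} (he : ∀ i, Orthonormal 𝕜 (e i)) :
    Orthonormal 𝕜 fun j : Σ i, w i => (lp.single 2 j.1 (e j.1 j.2) : lp E 2) := by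
  refine ⟨fun j => ?_, ?_⟩
  · rw [lp.norm_single (by norm_num)]
    exact (he j.1).norm_eq_one j.2
  · rintro ⟨i, a⟩ ⟨j, b⟩ h_ne
    rw [lp.inner_single_left]
    rcases eq_or_ne i j with rfl | hij
    · rw [lp.single_apply_self]
      exact (he i).inner_eq_zero fun hab => h_ne (congrArg (Sigma.mk i) hab)
    · rw [lp.single_apply_ne _ _ _ hij, inner_zero_right]

lemma exists_hilbertBasis_single [∀ i, CompleteSpace (E i)] :
    ∃ (s : Set (lp E 2)) (b : HilbertBasis s 𝕜 (lp E 2)) (N : s → ι) (y : ∀ j, E (N j)),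
      ∀ j, b j = lp.single 2 (N j) (y j) := by
  choose w e _ using fun i => exists_hilbertBasis 𝕜 (E i)
  set v : (Σ i, w i) → lp E 2 := fun j => lp.single 2 j.1 (e j.1 j.2)
  have hv : Orthonormal 𝕜 v := orthonormal_single fun i => (e i).orthonormal
  have h_total : (Submodule.span 𝕜 (Set.range ((↑) : Set.range v → lp E 2)))ᗮ = ⊥ := by
    rw [Subtype.range_coe, Submodule.eq_bot_iff]
    intro x hx
    ext i : 2
    refine (e i).repr.map_eq_zero_iff.1 (lp.ext (funext fun a => ?_))
    have h_inner := (Submodule.mem_orthogonal _ _).1 hx _ (Submodule.subset_span ⟨⟨i, a⟩, rfl⟩)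
    rw [lp.inner_single_left] at h_inner
    rwa [(e i).repr_apply_apply]
  refine ⟨Set.range v, .mkOfOrthogonalEqBot hv.toSubtypeRange h_total, ?_⟩
  choose j hj using fun z : Set.range v => z.2
  refine ⟨fun z => (j z).1, fun z => e (j z).1 (j z).2, fun z => ?_⟩
  rw [HilbertBasis.coe_mkOfOrthogonalEqBot]
  exact (hj z).symm

end Support

section Moments

variable {h : Type} [NormedAddCommGroup h] [InnerProductSpace ℂ h] {s : Set (Fock h)}
  {b : HilbertBasis s ℂ (Fock h)} {N : s → ℕ} {y : ∀ i, Sector h (N i)} {ρ : Fock h →L[ℂ] Fock h}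

lemma eq_zero_of_pow_mul_le_pow {a c q : ℝ} (hc : 0 ≤ c) (hca : c < a) (hq : 0 ≤ q)
    (h : ∀ k : ℕ, a ^ k * q ≤ c ^ k) : q = 0 := by
  have ha : 0 < a := hc.trans_lt hca
  have h_le (k : ℕ) : q ≤ (c / a) ^ k := by
    rw [div_pow, le_div_iff₀' (pow_pos ha k)]
    exact h k
  have h_lim : Filter.Tendsto (fun k : ℕ => (c / a) ^ k) Filter.atTop (nhds 0) :=
    tendsto_pow_atTop_nhds_zero_of_lt_one (by positivity) ((div_lt_one ha).2 hca)
  exact (ge_of_tendsto' h_lim h_le).antisymm hq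

lemma hasSum_pow_mul_re_inner {k : ℕ} {z : ℂ} (hz : HasExpectation ρ (opPow number k) z)
    (hb : ∀ i, b i = lp.single 2 (N i) (y i)) :
    HasSum (fun i => (N i : ℝ) ^ k * (⟪b i, ρ (b i)⟫_ℂ).re) z.re := by
  obtain ⟨h_dom, h_trace⟩ := hz
  have h_inner (i : s) : ⟪b i, opPow number k ⟨ρ (b i), h_dom (b i)⟩⟫_ℂ =
      ((N i ^ k : ℝ) : ℂ) * ⟪b i, ρ (b i)⟫_ℂ := by
    have h_apply := apply_eq_of_mem_graph_opPow_number
      (LinearPMap.mem_graph (opPow number k) ⟨ρ (b i), h_dom (b i)⟩) (N i)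
    conv_lhs => rw [hb i, lp.inner_single_left, ← hb i, h_apply, inner_smul_right]
    conv_rhs => rw [hb i, lp.inner_single_left, ← hb i]
    push_cast
    rfl
  simpa only [h_inner, Complex.reCLM_apply, Complex.re_ofReal_mul] using
    (h_trace s b).mapL Complex.reCLM

lemma re_nonneg_of_hasExpectation_opPow_number (hρ : ρ.IsPositive) {k : ℕ} {z : ℂ}
    (hz : HasExpectation ρ (opPow number k) z) : 0 ≤ z.re := by
  obtain ⟨s, b, N, y, hb⟩ := exists_hilbertBasis_single (𝕜 := ℂ) (E := Sector h)
  exact (hasSum_pow_mul_re_inner hz hb).nonneg fun i =>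
    mul_nonneg (by positivity) (hρ.re_inner_nonneg_right (b i))

variable {c : ℝ}

lemma nonneg_of_moments_le (hρ : ρ.IsPositive)
    (hc : ∀ k : ℕ, ∃ x : ℝ, HasExpectation ρ (opPow number k) (x : ℂ) ∧ x ≤ c ^ k) : 0 ≤ c := by
  obtain ⟨x, hx, hxc⟩ := hc 1
  rw [pow_one] at hxc
  exact (re_nonneg_of_hasExpectation_opPow_number hρ hx).trans hxc

lemma apply_basis_eq_zero_of_moments_le (hρ : ρ.IsPositive)
    (hc : ∀ k : ℕ, ∃ x : ℝ, HasExpectation ρ (opPow number k) (x : ℂ) ∧ x ≤ c ^ k)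
    (hb : ∀ i, b i = lp.single 2 (N i) (y i)) {i : s} (hi : c < N i) : ρ (b i) = 0 := by
  have h_nonneg (j : s) : 0 ≤ (⟪b j, ρ (b j)⟫_ℂ).re := hρ.re_inner_nonneg_right (b j)
  have h_re : (⟪b i, ρ (b i)⟫_ℂ).re = 0 := by
    refine eq_zero_of_pow_mul_le_pow (nonneg_of_moments_le hρ hc) hi (h_nonneg i) fun k => ?_
    obtain ⟨x, hx, hxc⟩ := hc k
    exact (le_hasSum (hasSum_pow_mul_re_inner hx hb) i fun j _ =>
      mul_nonneg (by positivity) (h_nonneg j)).trans hxc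
  exact apply_eq_zero_of_inner_eq_zero hρ
    (Complex.ext h_re (hρ.isSymmetric.im_inner_self_apply (b i)))

lemma cutoff_floor_comp_eq_of_moments_le (hρ : ρ.IsPositive)
    (hc : ∀ k : ℕ, ∃ x : ℝ, HasExpectation ρ (opPow number k) (x : ℂ) ∧ x ≤ c ^ k) :
    (cutoff 2 (fun n => ContinuousLinearMap.id ℂ (Sector h n)) ⌊c⌋₊).comp ρ = ρ := by
  obtain ⟨s, b, N, y, hb⟩ := exists_hilbertBasis_single (𝕜 := ℂ) (E := Sector h)
  ext x : 1
  refine b.repr.injective (lp.ext (funext fun i => ?_))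
  rw [b.repr_apply_apply, b.repr_apply_apply, hb i, lp.inner_single_left,
    ContinuousLinearMap.comp_apply, cutoff_apply]
  split_ifs with hi
  · rw [lp.inner_single_left, ContinuousLinearMap.id_apply]
  · rw [Nat.le_floor_iff (nonneg_of_moments_le hρ hc), not_le] at hi
    rw [inner_zero_right, ← hb i, ← hρ.isSymmetric.apply_clm,
      apply_basis_eq_zero_of_moments_le hρ hc hb hi, inner_zero_left]

end Moments

section Reservoir

lemma ReservoirBound.mono {H : Type} [NormedAddCommGroup H] [InnerProductSpace ℂ H]
    {ρM : (M : ℕ) → (TensorPower H M →L[ℂ] TensorPower H M)} {v : ℝ → (H →ₗ.[ℂ] H)}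
    {C C' : ℕ → ℝ} {b : ℝ → ℝ} (h : ReservoirBound ρM v C b) (hC : ∀ n, C n ≤ C' n)
    (hb : ∀ t, 0 ≤ b t) : ReservoirBound ρM v C' b := by
  intro n t ht M hM
  obtain ⟨z, hz, h_norm⟩ := h n t ht M hM
  exact ⟨z, hz, h_norm.trans
    (mul_le_mul_of_nonneg_right (hC n) (Finset.prod_nonneg fun i _ => hb (t i)))⟩

lemma norm_phase_le {d : ℕ} {θ : EuclideanSpace ℝ (Fin d) → ℝ} (hθ : Measurable θ) :
    ‖phase θ hθ‖ ≤ 1 :=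
  LinearMap.mkContinuous_norm_le _ zero_le_one _

variable {h : Type} [NormedAddCommGroup h] [InnerProductSpace ℂ h]

lemma isBlockDiagonal_conj_scattering (U V : h →L[ℂ] h) (g : h) :
    IsBlockDiagonal (opMul (secondQuantization U) (opMul (scattering g) (secondQuantization V)))
      fun n => (quantizationSector U n).comp
        ((scatteringSector g n).comp (quantizationSector V n)) :=
  (isBlockDiagonal_secondQuantization U).opMul
    ((isBlockDiagonal_scattering g).opMul (isBlockDiagonal_secondQuantization V))

lemma norm_cutoff_conj_scattering_le {U V : h →L[ℂ] h} (hU : ‖U‖ ≤ 1) (hV : ‖V‖ ≤ 1) (g : h)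
    {c : ℝ} (hc : 0 ≤ c) :
    ‖cutoff 2 (fun n => (quantizationSector U n).comp
      ((scatteringSector g n).comp (quantizationSector V n))) ⌊c⌋₊‖ ≤ c * ‖g‖ ^ 2 := by
  refine norm_cutoff_le fun n hn => ?_
  have hΓ {U : h →L[ℂ] h} (hU : ‖U‖ ≤ 1) : ‖quantizationSector U n‖ ≤ 1 :=
    (norm_quantizationSector_le U n).trans (pow_le_one₀ (norm_nonneg U) hU)
  refine (norm_comp_scatteringSector_comp_le (hΓ hU) (hΓ hV) g).trans ?_
  gcongr
  exact (Nat.le_floor_iff hc).1 hn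

end Reservoir

end MeanField

end

open MeanField in
theorem mainTheorem9_general {h : Type} [NormedAddCommGroup h] [InnerProductSpace ℂ h]
    {U V : ℝ → h →L[ℂ] h} (hU : ∀ t, ‖U t‖ ≤ 1) (hV : ∀ t, ‖V t‖ ≤ 1) (g : h) :
    IsBoundedBy (opMul (scattering g) (number + opOne).inverse) (‖g‖ ^ 2) ∧
    ∀ (ρ : Fock h →L[ℂ] Fock h) (c : ℝ), IsDensityMatrix ρ →
      (∀ k : ℕ, ∃ x : ℝ, HasExpectation ρ (opPow number k) (x : ℂ) ∧ x ≤ c ^ k) →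
      ReservoirBound (fun M => tensorMap ρ M)
        (fun t => opMul (secondQuantization (U t))
          (opMul (scattering g) (secondQuantization (V t))))
        (fun n => (c * ‖g‖ ^ 2) ^ n) (fun _ => 1) :=
  ⟨isBoundedBy_scattering_inverse_number_add_one g, fun _ _ hρ hc =>
    reservoirBound_of_isCutoff hρ
      (fun t => (isBlockDiagonal_conj_scattering (U t) (V t) g).isCutoff)
      (cutoff_floor_comp_eq_of_moments_le hρ.1 hc) fun t =>
        norm_cutoff_conj_scattering_le (hU t) (hV t) g (nonneg_of_moments_le hρ.1 hc)⟩

theorem mainTheorem9 (d : ℕ) (ω : EuclideanSpace ℝ (Fin d) → ℝ) (hω : Measurable ω)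
    (_hω0 : ∀ k, 0 ≤ ω k) (g : MeanField.OneParticle d) :
    MeanField.IsBoundedBy (MeanField.opMul (MeanField.scattering g)
      (MeanField.number + MeanField.opOne).inverse) (2 * ‖g‖ ^ 2) ∧
    ∀ (ρ : MeanField.Fock (MeanField.OneParticle d) →L[ℂ]
        MeanField.Fock (MeanField.OneParticle d)) (c : ℝ),
      MeanField.IsDensityMatrix ρ →
      (∀ k : ℕ, ∃ x : ℝ,
        MeanField.HasExpectation ρ (MeanField.opPow MeanField.number k) (x : ℂ) ∧ x ≤ c ^ k) →
      MeanField.ReservoirBound (fun M => MeanField.tensorMap ρ M)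
        (MeanField.heisenberg ω hω (MeanField.scattering g))
        (fun n => (2 * c * ‖g‖ ^ 2) ^ n) (fun _ => 1) := by
  obtain ⟨h_bounded, h_reservoir⟩ := mainTheorem9_general (fun t => MeanField.norm_phase_le
    (hω.const_mul t)) (fun t => MeanField.norm_phase_le (hω.const_mul (-t))) g
  refine ⟨h_bounded.mono (by linarith [sq_nonneg ‖g‖]), fun ρ c hρ hc =>
    (h_reservoir ρ c hρ hc).mono (fun n => ?_) fun _ => zero_le_one⟩
  have hc_nonneg : 0 ≤ c := MeanField.nonneg_of_moments_le hρ.1 hc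
  gcongr
  linarith
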